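/- Let $m\ge 1$ be an integer and $0<\alpha<m$. Let $1<p<p_i<\infty$, $1<q_i<\infty$ and $-1/p_i<\lambda_i<0$ for $i=1,\dots,m$, with $$\frac1p=\sum_{i=1}^m\frac1{p_i}+\sum_{i=1}^m\frac1{q_i},\qquad \lambda=\sum_{i=1}^m\lambda_i .$$ For $B(0,R)=(-R,R)\subset\mathbb R$ with $|B(0,R)|=2R$, let $\dot B^{p_i,\lambda_i}(\mathbb R)$ be the central Morrey space of all locally $p_i$-integrable $f:\mathbb R\to\mathbb C$ with $$\|f\|_{\dot B^{p_i,\lambda_i}}=\sup_{R>0}\Big(\frac1{|B(0,R)|^{1+\lambda_i p_i}}\int_{B(0,R)}|f(x)|^{p_i}\,dx\Big)^{1/p_i}<\infty ,$$ let $\dot B^{p,\lambda}(x^{-p\alpha}dx)$ be the space of all measurable $g:(0,\infty)\to\mathbb C$ with $$\|g\|_{\dot B^{p,\lambda}(x^{-p\alpha}dx)}=\sup_{R>0}\Big(\frac1{|B(0,R)|^{1+\lambda p}}\int_0^R|g(x)|^{p}\,x^{-p\alpha}\,dx\Big)^{1/p}<\infty ,$$ and let $C\dot MO^{q}(\mathbb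 R)$ be the space of all locally $q$-integrable $b:\mathbb R\to\mathbb C$ with $$\sup_{R>0}\Big(\frac1{|B(0,R)|}\int_{B(0,R)}|b(x)-b_{B(0,R)}|^{q}\,dx\Big)^{1/q}<\infty,\qquad b_{B}=\frac1{|B|}\int_{B}b .$$ For $\vec b=(b_1,\dots,b_m)$ and $\vec f=(f_1,\dots,f_m)$, the commutator of the multilinear Riemann–Liouville operator is $$I^m_{\alpha,\vec b}\vec f(x)=\frac1{\Gamma(\alpha)}\int_{0<t_1,\dots,t_m<x}\frac{\prod_{i=1}^m f_i(t_i)\,\prod_{i=1}^m\big(b_i(x)-b_i(t_i)\big)}{|(x-t_1,\dots,x-t_m)|^{m-\alpha}}\,d\vec t,\qquad x>0,$$ where $|\cdot|$ is the Euclidean norm on $\mathbb R^m$. Then, for all $b_i\in C\dot MO^{q_i}(\mathbb R)$, $i=1,\dots,m$, the operator $I^m_{\alpha,\vec b}$ is bounded from $\dot B^{p_1,\lambda_1}(\mathbb R)\times\cdots\times\dot B^{p_m,\lambda_m}(\mathbb R)$ to $\dot B^{p,\lambda}(x^{-p\alpha}dx)$: there is a constant $C<\infty$, independent of $\vec f$,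 such that for all $f_i\in\dot B^{p_i,\lambda_i}(\mathbb R)$ the integral defining $I^m_{\alpha,\vec b}\vec f(x)$ converges absolutely for almost every $x>0$, $I^m_{\alpha,\vec b}\vec f\in\dot B^{p,\lambda}(x^{-p\alpha}dx)$, and $$\|I^m_{\alpha,\vec b}\vec f\|_{\dot B^{p,\lambda}(x^{-p\alpha}dx)}\le C\prod_{i=1}^m\|f_i\|_{\dot B^{p_i,\lambda_i}} .$$ -/

import Mathlib

open MeasureTheory Set
open scoped ENNReal NNReal

noncomputable section

/-- The central Morrey norm on the line, taken with respect to a measure `μ`: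
`sup_{R > 0} ( |B(0,R)|^{-(1 + lam * p)} ∫_{B(0,R)} |f|^p dμ )^{1/p}`,
where `|B(0,R)|` is always Lebesgue measure. For `μ = volume` it is the usual norm
of the central Morrey space of exponents `p`, `lam`. -/
def centralMorreyNorm (p lam : ℝ) (μ : Measure ℝ) (f : ℝ → ℂ) : ℝ≥0∞ :=
  ⨆ (R : ℝ) (_ : 0 < R),
    ((∫⁻ x in Metric.ball (0 : ℝ) R, ‖f x‖ₑ ^ p ∂μ) /
      (volume (Metric.ball (0 : ℝ) R)) ^ (1 + lam * p)) ^ (1 / p)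

/-- `f` belongs to the central Morrey space with respect to `μ`: it is locally `p`-integrable
and its central Morrey norm is finite. -/
structure MemCentralMorrey (p lam : ℝ) (μ : Measure ℝ) (f : ℝ → ℂ) : Prop where
  memLp_of_isCompact : ∀ K : Set ℝ, IsCompact K → MemLp f (ENNReal.ofReal p) (μ.restrict K)
  norm_lt_top : centralMorreyNorm p lam μ f < ∞

/-- The measure `x ^ (-c) dx` on the half-line `(0, ∞)`. -/
def halfLinePowerMeasure (c : ℝ) : Measure ℝ :=
  (volume.restrict (Ioi (0 : ℝ))).withDensity fun x => ENNReal.ofReal (x ^ (-c))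

/-- The central mean oscillation seminorm of exponent `q` on the line. -/
def centralMeanOscillationNorm (q : ℝ) (b : ℝ → ℂ) : ℝ≥0∞ :=
  ⨆ (R : ℝ) (_ : 0 < R),
    ((∫⁻ x in Metric.ball (0 : ℝ) R, ‖b x - ⨍ y in Metric.ball (0 : ℝ) R, b y‖ₑ ^ q) /
      volume (Metric.ball (0 : ℝ) R)) ^ (1 / q)

/-- `b` belongs to the central BMO space of exponent `q` on the line. -/
structure MemCentralBMO (q : ℝ) (b : ℝ → ℂ) : Prop where
  memLp_of_isCompact :
    ∀ K : Set ℝ, IsCompact K → MemLp b (ENNReal.ofReal q) (volume.restrict K)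
  norm_lt_top : centralMeanOscillationNorm q b < ∞

/-- The integrand, in `t`, of the commutator of the multilinear Riemann-Liouville operator at
the point `x`:
`∏ f_i(t_i) ∏ (b_i(x) - b_i(t_i)) / |(x - t_1, …, x - t_m)|^(m - α)`, Euclidean norm. -/
def riemannLiouvilleCommutatorIntegrand {m : ℕ} (α : ℝ) (b f : Fin m → ℝ → ℂ) (x : ℝ)
    (t : Fin m → ℝ) : ℂ :=
  ((∏ i, f i (t i)) * ∏ i, (b i x - b i (t i))) /
    ((‖(WithLp.toLp 2 (fun i => x - t i) : EuclideanSpace ℝ (Fin m))‖ ^ ((m : ℝ) - α) : ℝ) : ℂ)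

/-- The commutator of the multilinear Riemann-Liouville operator: the integral of the above over
`0 < t_1, …, t_m < x`, divided by `Γ(α)`. -/
def riemannLiouvilleCommutator {m : ℕ} (α : ℝ) (b f : Fin m → ℝ → ℂ) (x : ℝ) : ℂ :=
  ((1 / Real.Gamma α : ℝ) : ℂ) *
    ∫ t in {t : Fin m → ℝ | ∀ i, 0 < t i ∧ t i < x},
      riemannLiouvilleCommutatorIntegrand α b f x t

end

/-! The kernel decouples. The Euclidean norm of `(x - t_1, …, x - t_m)` is at least each `x - t_i`,
and `α < m`, so the kernel is at most `∏ (x - t_i) ^ (β - 1)` with `β = α / m`. By Tonelli, `x ^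
(-α)` times the integral of the absolute values is at most a product of one-dimensional operators
(`commutatorMajorant`).

For one factor, `t = s * x` turns the operator into an average of dilations over `s ∈ (0, 1)` with
weight `(1 - s) ^ (β - 1)`. With `1 / r = 1 / P + 1 / Q`, Hölder bounds the `L ^ r` norm of one
dilation on `(0, R)`: dilating `f` costs `s ^ l`. Comparing both `b x` and `b (s * x)` with the mean
over the same ball `B(0, R)` costs `s ^ (-1 / Q)`, so no telescoping over dyadic balls is needed
(`lintegral_dilation_rpow_le`). Minkowski's inequality leaves the Beta integral of `s ^ (l - 1 / Q)
* (1 - s) ^ (β - 1)`, finite because `l > -1 / P` and `1 / P + 1 / Q < 1`.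

Hölder over the factors, with `∑ 1 / r_i = 1 / p`, gives the norm bound. It also makes the product
finite almost everywhere, which is absolute convergence. -/

/-! ### Integral inequalities: Tonelli, dilation, Minkowski, Beta integral. -/

/-- Tonelli's theorem for a product of functions of separate coordinates. -/
theorem lintegral_fin_prod_eq_prod {n : ℕ} {μ : Fin n → Measure ℝ} [∀ i, SigmaFinite (μ i)]
    {f : Fin n → ℝ → ℝ≥0∞} (hf : ∀ i, AEMeasurable (f i) (μ i)) :
    ∫⁻ t : Fin n → ℝ, ∏ i, f i (t i) ∂(Measure.pi μ) = ∏ i, ∫⁻ x, f i x ∂(μ i) := by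
  induction n with
  | zero => simp
  | succ n ih =>
    have hg : AEMeasurable (fun t : Fin n → ℝ => ∏ i : Fin n, f i.succ (t i))
        (Measure.pi fun i => μ i.succ) :=
      Finset.aemeasurable_fun_prod _ fun i _ =>
        (hf i.succ).comp_quasiMeasurePreserving (Measure.quasiMeasurePreserving_eval _ i)
    have he := lintegral_map_equiv (μ := (μ 0).prod (Measure.pi fun i => μ i.succ))
      (fun t : Fin (n + 1) → ℝ => ∏ i, f i (t i))
      (MeasurableEquiv.piFinSuccAbove (fun _ => ℝ) 0).symm
    have hmap := ((measurePreserving_piFinSuccAbove μ 0).symm).map_eq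
    simp only [Fin.zero_succAbove] at hmap
    rw [hmap] at he
    rw [Fin.prod_univ_succ, ← ih fun i => hf i.succ, ← lintegral_prod_mul (hf 0) hg, he]
    refine lintegral_congr fun z => ?_
    simp [MeasurableEquiv.piFinSuccAbove_symm_apply, Fin.insertNthEquiv, Fin.prod_univ_succ]

/-- Dilation is a measurable equivalence, so `g` may be arbitrary. -/
theorem lintegral_Ioo_comp_mul_left {a : ℝ} (ha : 0 < a) (R : ℝ) (g : ℝ → ℝ≥0∞) :
    ∫⁻ x in Ioo 0 R, g (a * x) = ENNReal.ofReal a⁻¹ * ∫⁻ y in Ioo 0 (a * R), g y := by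
  rw [← lintegral_indicator measurableSet_Ioo, ← lintegral_indicator measurableSet_Ioo]
  have h := lintegral_map_equiv (μ := volume) ((Ioo 0 (a * R)).indicator g)
    (Homeomorph.mulLeft₀ a ha.ne').toMeasurableEquiv
  have hm : Measure.map (Homeomorph.mulLeft₀ a ha.ne').toMeasurableEquiv volume
      = ENNReal.ofReal |a⁻¹| • (volume : Measure ℝ) := Real.map_volume_mul_left ha.ne'
  rw [hm, lintegral_smul_measure, abs_of_pos (inv_pos.2 ha), smul_eq_mul] at h
  rw [h]
  refine lintegral_congr fun x => ?_
  simp only [indicator, Homeomorph.toMeasurableEquiv_coe, Homeomorph.coe_mulLeft₀, mem_Ioo,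
    mul_pos_iff_of_pos_left ha, mul_lt_mul_iff_right₀ ha]

/-- A form of Minkowski's integral inequality: if every slice has `L ^ r` norm at most `A * g s`,
the integral of the slices has `L ^ r` norm at most `A * ∫ g`. -/
theorem lintegral_rpow_lintegral_le {X S : Type*} [MeasurableSpace X] [MeasurableSpace S]
    {ν : Measure X} {μ : Measure S} [SFinite ν] [SFinite μ] {r : ℝ} (hr : 1 < r)
    {F : X → S → ℝ≥0∞} (hF : Measurable (Function.uncurry F)) {g : S → ℝ≥0∞} (hg : Measurable g)
    {A : ℝ≥0∞} (hg0 : ∀ᵐ s ∂μ, g s ≠ 0) (hgt : ∀ᵐ s ∂μ, g s ≠ ∞)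
    (h : ∀ᵐ s ∂μ, ∫⁻ x, F x s ^ r ∂ν ≤ (A * g s) ^ r) :
    ∫⁻ x, (∫⁻ s, F x s ∂μ) ^ r ∂ν ≤ (A * ∫⁻ s, g s ∂μ) ^ r := by
  have hr0 : 0 < r := by linarith
  have hr1 : 0 < r - 1 := by linarith
  have hc := Real.HolderConjugate.conjExponent hr
  set k := r.conjExponent with hk
  have hk0 : 0 < k := hc.symm.pos
  have hkr : 1 / k * r = r - 1 := by
    have := hc.inv_add_inv_eq_one
    field_simp at this ⊢
    nlinarith
  have hFm : ∀ x, Measurable (F x) := fun x => hF.comp measurable_prodMk_left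
  have hGm : Measurable fun s => g s ^ (-(r - 1)) := hg.pow_const _
  -- Hölder in `s` after writing `F = (F * g ^ (-1/k)) * g ^ (1/k)`, with `k` conjugate to `r`.
  have point : ∀ x, (∫⁻ s, F x s ∂μ) ^ r ≤
      (∫⁻ s, F x s ^ r * g s ^ (-(r - 1)) ∂μ) * (∫⁻ s, g s ∂μ) ^ (r - 1) := by
    intro x
    have e1 : ∫⁻ s, F x s ∂μ =
        ∫⁻ s, ((fun s => F x s * g s ^ (-(1 / k))) * fun s => g s ^ (1 / k)) s ∂μ := by
      refine lintegral_congr_ae ?_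
      filter_upwards [hg0, hgt] with s h0 ht
      simp only [Pi.mul_apply]
      rw [mul_assoc, ← ENNReal.rpow_add _ _ h0 ht]
      simp
    have e2 := ENNReal.lintegral_mul_le_Lp_mul_Lq μ hc
      (f := fun s => F x s * g s ^ (-(1 / k))) (g := fun s => g s ^ (1 / k))
      ((hFm x).mul (hg.pow_const _)).aemeasurable (hg.pow_const _).aemeasurable
    rw [← e1] at e2
    calc (∫⁻ s, F x s ∂μ) ^ r ≤ _ := ENNReal.rpow_le_rpow e2 hr0.le
      _ = _ := by
        rw [ENNReal.mul_rpow_of_nonneg _ _ hr0.le, ← ENNReal.rpow_mul, ← ENNReal.rpow_mul,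
          one_div_mul_cancel hr0.ne', ENNReal.rpow_one, hkr]
        congr 1
        · refine lintegral_congr fun s => ?_
          rw [ENNReal.mul_rpow_of_nonneg _ _ hr0.le, ← ENNReal.rpow_mul, neg_mul, hkr]
        · congr 1
          refine lintegral_congr fun s => ?_
          rw [← ENNReal.rpow_mul, one_div_mul_cancel hk0.ne', ENNReal.rpow_one]
  have hJ : Measurable (Function.uncurry fun x s => F x s ^ r * g s ^ (-(r - 1))) :=
    (hF.pow_const r).mul (hGm.comp measurable_snd)
  calc ∫⁻ x, (∫⁻ s, F x s ∂μ) ^ r ∂ν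
      ≤ ∫⁻ x, (∫⁻ s, F x s ^ r * g s ^ (-(r - 1)) ∂μ) * (∫⁻ s, g s ∂μ) ^ (r - 1) ∂ν :=
        lintegral_mono point
    _ = (∫⁻ s, ∫⁻ x, F x s ^ r * g s ^ (-(r - 1)) ∂ν ∂μ) * (∫⁻ s, g s ∂μ) ^ (r - 1) := by
        rw [lintegral_mul_const _ hJ.lintegral_prod_right, lintegral_lintegral_swap hJ.aemeasurable]
    -- After the swap, the slice bound cancels the weight: `(A * g) ^ r * g ^ (-(r - 1)) = A ^ r *
    -- g`.
    _ ≤ (∫⁻ s, A ^ r * g s ∂μ) * (∫⁻ s, g s ∂μ) ^ (r - 1) := by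
        gcongr 1
        refine lintegral_mono_ae ?_
        filter_upwards [hg0, hgt, h] with s h0 ht hs
        have hFs : Measurable fun x => F x s := hF.comp measurable_prodMk_right
        rw [lintegral_mul_const _ (hFs.pow_const r)]
        calc _ ≤ (A * g s) ^ r * g s ^ (-(r - 1)) := by gcongr
          _ = A ^ r * g s := by
            rw [ENNReal.mul_rpow_of_nonneg _ _ hr0.le, mul_assoc, ← ENNReal.rpow_add _ _ h0 ht]
            simp
    _ = (A * ∫⁻ s, g s ∂μ) ^ r := by
        rw [lintegral_const_mul _ hg, ENNReal.mul_rpow_of_nonneg _ _ hr0.le, mul_assoc]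
        congr 1
        nth_rw 1 [← ENNReal.rpow_one (∫⁻ s, g s ∂μ)]
        rw [← ENNReal.rpow_add_of_nonneg _ _ zero_le_one hr1.le]
        congr 1
        ring

/-- The integrand is a constant multiple of the Beta density with parameters `u + 1` and `v + 1`,
whose total mass is one. -/
theorem lintegral_rpow_mul_one_sub_rpow_lt_top {u v : ℝ} (hu : -1 < u) (hv : -1 < v) :
    ∫⁻ s in Ioo (0 : ℝ) 1, ENNReal.ofReal (s ^ u) * ENNReal.ofReal ((1 - s) ^ v) < ∞ := by
  have hB := ProbabilityTheory.beta_pos (α := u + 1) (β := v + 1) (by linarith) (by linarith)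
  have h1 := ProbabilityTheory.lintegral_betaPDF_eq_one (α := u + 1) (β := v + 1)
    (by linarith) (by linarith)
  rw [ProbabilityTheory.lintegral_betaPDF] at h1
  have h2 : ∫⁻ s in Ioo (0 : ℝ) 1, ENNReal.ofReal (s ^ u) * ENNReal.ofReal ((1 - s) ^ v)
      = ENNReal.ofReal (ProbabilityTheory.beta (u + 1) (v + 1)) * 1 := by
    rw [← h1, ← lintegral_const_mul' _ _ ENNReal.ofReal_ne_top]
    refine setLIntegral_congr_fun measurableSet_Ioo fun s hs => ?_
    rw [← ENNReal.ofReal_mul (Real.rpow_nonneg hs.1.le _), ← ENNReal.ofReal_mul hB.le]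
    congr 1
    simp only [add_sub_cancel_right]
    field_simp
  rw [h2, mul_one]
  exact ENNReal.ofReal_lt_top

/-! ### The one-dimensional majorant. -/

/-- The one-dimensional positive operator, normalised to be homogeneous of degree zero, whose
products dominate the multilinear commutator. -/
noncomputable def commutatorMajorant (β : ℝ) (b f : ℝ → ℂ) (x : ℝ) : ℝ≥0∞ :=
  ENNReal.ofReal (x ^ (-β)) *
    ∫⁻ t in Ioo 0 x, ‖f t‖ₑ * ‖b x - b t‖ₑ * ENNReal.ofReal ((x - t) ^ (β - 1))

/-- Substitution `t = s * x`; the powers of `x` cancel since `-β + 1 + (β - 1) = 0`. -/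
theorem commutatorMajorant_eq_lintegral_Ioo_zero_one (β : ℝ) (b f : ℝ → ℂ) {x : ℝ} (hx : 0 < x) :
    commutatorMajorant β b f x =
      ∫⁻ s in Ioo (0 : ℝ) 1, ‖f (s * x)‖ₑ * ‖b x - b (s * x)‖ₑ *
        ENNReal.ofReal ((1 - s) ^ (β - 1)) := by
  have h := lintegral_Ioo_comp_mul_left hx 1
    fun t => ‖f t‖ₑ * ‖b x - b t‖ₑ * ENNReal.ofReal ((x - t) ^ (β - 1))
  rw [mul_one] at h
  have hx' : (∫⁻ t in Ioo 0 x, ‖f t‖ₑ * ‖b x - b t‖ₑ * ENNReal.ofReal ((x - t) ^ (β - 1))) =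
      ENNReal.ofReal x * ∫⁻ s in Ioo (0 : ℝ) 1, ‖f (x * s)‖ₑ * ‖b x - b (x * s)‖ₑ *
        ENNReal.ofReal ((x - x * s) ^ (β - 1)) := by
    rw [h, ← mul_assoc, ← ENNReal.ofReal_mul hx.le, mul_inv_cancel₀ hx.ne', ENNReal.ofReal_one,
      one_mul]
  rw [commutatorMajorant, hx', ← mul_assoc, ← ENNReal.ofReal_mul (by positivity),
    ← lintegral_const_mul' _ _ ENNReal.ofReal_ne_top]
  refine setLIntegral_congr_fun measurableSet_Ioo fun s hs => ?_
  have e : x ^ (-β) * x * (x - x * s) ^ (β - 1) = (1 - s) ^ (β - 1) := by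
    rw [← mul_one_sub, Real.mul_rpow hx.le (by linarith [hs.2]), ← mul_assoc]
    nth_rw 2 [← Real.rpow_one x]
    rw [← Real.rpow_add hx, ← Real.rpow_add hx]
    simp
  rw [← e, ENNReal.ofReal_mul (q := (x - x * s) ^ (β - 1)) (by positivity), mul_comm s x]
  ring

/-- Once the domain `(0, 1)` no longer depends on `x`, the integrand is jointly measurable. The
indicator is there because the substitution needs `x > 0`. -/
theorem measurable_commutatorMajorant {β : ℝ} {b f : ℝ → ℂ} (hb : Measurable b)
    (hf : Measurable f) : Measurable ((Ioi (0 : ℝ)).indicator (commutatorMajorant β b f)) := by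
  have h : (Ioi (0 : ℝ)).indicator (commutatorMajorant β b f) =
      (Ioi (0 : ℝ)).indicator fun x => ∫⁻ s in Ioo (0 : ℝ) 1,
        ‖f (s * x)‖ₑ * ‖b x - b (s * x)‖ₑ * ENNReal.ofReal ((1 - s) ^ (β - 1)) :=
    indicator_congr fun x hx => commutatorMajorant_eq_lintegral_Ioo_zero_one β b f hx
  rw [h]
  refine Measurable.indicator (Measurable.lintegral_prod_right' (f := fun z : ℝ × ℝ =>
    ‖f (z.2 * z.1)‖ₑ * ‖b z.1 - b (z.2 * z.1)‖ₑ * ENNReal.ofReal ((1 - z.2) ^ (β - 1))) ?_)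
    measurableSet_Ioi
  fun_prop

/-- The `L ^ r` norm on `(0, R)` of a single dilation `x ↦ f (s * x) * (b x - b (s * x))`. -/
theorem lintegral_dilation_rpow_le {P Q r l : ℝ} (hP : 1 < P) (hQ : 1 < Q) (hr : 0 < r)
    (hPQ : 1 / r = 1 / P + 1 / Q) {b f : ℝ → ℂ} (hb : Measurable b) (hf : Measurable f)
    {M N : ℝ≥0∞}
    (hN : ∀ R : ℝ, 0 < R → ∫⁻ x in Ioo 0 R, ‖f x‖ₑ ^ P ≤
      N ^ P * ENNReal.ofReal (2 * R) ^ (1 + l * P))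
    (hM : ∀ R : ℝ, 0 < R → ∃ c : ℂ, ∫⁻ x in Ioo 0 R, ‖b x - c‖ₑ ^ Q ≤
      M ^ Q * ENNReal.ofReal (2 * R))
    {R : ℝ} (hR : 0 < R) {s : ℝ} (hs : s ∈ Ioo (0 : ℝ) 1) :
    ∫⁻ x in Ioo 0 R, (‖f (s * x)‖ₑ * ‖b x - b (s * x)‖ₑ) ^ r ≤
      (2 * M * N * ENNReal.ofReal (2 * R) ^ (1 / r + l) * ENNReal.ofReal (s ^ (l - 1 / Q))) ^ r := by
  have hP0 : 0 < P := by linarith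
  have hQ0 : 0 < Q := by linarith
  have hrP : r < P := by
    have : 1 / P < 1 / r := by rw [hPQ]; linarith [one_div_pos.2 hQ0]
    exact (one_div_lt_one_div hP0 hr).1 this
  obtain ⟨hs0, hs1⟩ := hs
  have hV0 : ENNReal.ofReal (2 * R) ≠ 0 := by simpa using hR
  have hVt : ENNReal.ofReal (2 * R) ≠ ∞ := ENNReal.ofReal_ne_top
  have hS0 : ENNReal.ofReal s ≠ 0 := by simpa using hs0
  have hSt : ENNReal.ofReal s ≠ ∞ := ENNReal.ofReal_ne_top
  have hsR : ENNReal.ofReal (2 * (s * R)) = ENNReal.ofReal s * ENNReal.ofReal (2 * R) := by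
    rw [← ENNReal.ofReal_mul hs0.le]; congr 1; ring
  have hsi : ENNReal.ofReal s⁻¹ = ENNReal.ofReal s ^ (-1 : ℝ) := by
    rw [ENNReal.ofReal_inv_of_pos hs0, ENNReal.rpow_neg_one]
  set V := ENNReal.ofReal (2 * R) with hV
  set σ := ENNReal.ofReal s with hσ
  -- The Jacobian `s⁻¹` and the factor `s ^ (1 + l * P)` from radius `s * R` leave `s ^ (l * P)`.
  have h1 : (∫⁻ x in Ioo 0 R, ‖f (s * x)‖ₑ ^ P) ^ (1 / P) ≤ N * σ ^ l * V ^ (1 / P + l) := by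
    have e : (∫⁻ x in Ioo 0 R, ‖f (s * x)‖ₑ ^ P) ≤ (N * σ ^ l * V ^ (1 / P + l)) ^ P := by
      rw [lintegral_Ioo_comp_mul_left hs0 R fun y => ‖f y‖ₑ ^ P, hsi]
      refine (mul_le_mul_right (hN (s * R) (by positivity)) _).trans_eq ?_
      rw [hsR, ENNReal.mul_rpow_of_ne_top hSt hVt, ENNReal.mul_rpow_of_nonneg _ _ hP0.le,
        ENNReal.mul_rpow_of_nonneg _ _ hP0.le, ← ENNReal.rpow_mul, ← ENNReal.rpow_mul,
        show (1 / P + l) * P = 1 + l * P by field_simp,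
        show l * P = -1 + (1 + l * P) by ring, ENNReal.rpow_add (-1) _ hS0 hSt,
        show 1 + (-1 + (1 + l * P)) = 1 + l * P by ring]
      ring
    calc _ ≤ ((N * σ ^ l * V ^ (1 / P + l)) ^ P) ^ (1 / P) := by gcongr
      _ = _ := by rw [← ENNReal.rpow_mul, mul_one_div_cancel hP0.ne', ENNReal.rpow_one]
  have h2 : (∫⁻ x in Ioo 0 R, ‖b x - b (s * x)‖ₑ ^ Q) ^ (1 / Q) ≤
      2 * M * σ ^ (-(1 / Q)) * V ^ (1 / Q) := by
    obtain ⟨c, hc⟩ := hM R hR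
    have a1 : (∫⁻ x in Ioo 0 R, ‖b x - c‖ₑ ^ Q) ^ (1 / Q) ≤ M * V ^ (1 / Q) := by
      calc _ ≤ (M ^ Q * V) ^ (1 / Q) := by gcongr
        _ = _ := by
          rw [ENNReal.mul_rpow_of_nonneg _ _ (by positivity), ← ENNReal.rpow_mul,
            mul_one_div_cancel hQ0.ne', ENNReal.rpow_one]
    -- The constant `c` of the ball of radius `R` is kept: enlarging `(0, s * R)` to `(0, R)` loses
    -- only the Jacobian.
    have a2 : (∫⁻ x in Ioo 0 R, ‖b (s * x) - c‖ₑ ^ Q) ^ (1 / Q) ≤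
        σ ^ (-(1 / Q)) * (M * V ^ (1 / Q)) := by
      rw [lintegral_Ioo_comp_mul_left hs0 R fun y => ‖b y - c‖ₑ ^ Q, hsi,
        ENNReal.mul_rpow_of_nonneg _ _ (by positivity), ← ENNReal.rpow_mul,
        show (-1 : ℝ) * (1 / Q) = -(1 / Q) by ring]
      gcongr
      refine le_trans ?_ a1
      gcongr
      nlinarith
    -- Absorbs the undilated term into the dilated one, whence the factor `2`.
    have a3 : 1 ≤ σ ^ (-(1 / Q)) :=
      ENNReal.one_le_rpow_of_pos_of_le_one_of_neg (pos_iff_ne_zero.2 hS0)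
        (ENNReal.ofReal_le_one.2 hs1.le) (by simpa using hQ0)
    calc (∫⁻ x in Ioo 0 R, ‖b x - b (s * x)‖ₑ ^ Q) ^ (1 / Q)
        ≤ (∫⁻ x in Ioo 0 R, ((fun x => ‖b x - c‖ₑ) + fun x => ‖b (s * x) - c‖ₑ) x ^ Q) ^ (1 / Q) := by
          gcongr with x
          calc ‖b x - b (s * x)‖ₑ = ‖(b x - c) - (b (s * x) - c)‖ₑ := by congr 1; ring
            _ ≤ _ := enorm_sub_le
      _ ≤ _ := ENNReal.lintegral_Lp_add_le (by fun_prop) (by fun_prop) hQ.le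
      _ ≤ 1 * (M * V ^ (1 / Q)) + σ ^ (-(1 / Q)) * (M * V ^ (1 / Q)) := by
        rw [one_mul]; exact add_le_add a1 a2
      _ ≤ σ ^ (-(1 / Q)) * (M * V ^ (1 / Q)) + σ ^ (-(1 / Q)) * (M * V ^ (1 / Q)) := by gcongr
      _ = _ := by ring
  have h3 := ENNReal.lintegral_Lp_mul_le_Lq_mul_Lr hr hrP hPQ (volume.restrict (Ioo 0 R))
    (f := fun x => ‖f (s * x)‖ₑ) (g := fun x => ‖b x - b (s * x)‖ₑ) (by fun_prop) (by fun_prop)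
  have h4 := h3.trans (mul_le_mul' h1 h2)
  have h5 := ENNReal.rpow_le_rpow h4 hr.le
  rw [← ENNReal.rpow_mul, one_div_mul_cancel hr.ne', ENNReal.rpow_one] at h5
  refine h5.trans_eq ?_
  congr 1
  rw [← ENNReal.ofReal_rpow_of_pos hs0, ← hσ, sub_eq_add_neg, ENNReal.rpow_add _ _ hS0 hSt,
    show 1 / r + l = (1 / P + l) + 1 / Q by rw [hPQ]; ring, ENNReal.rpow_add _ (1 / Q) hV0 hVt]
  ring

/-- Boundedness of the one-dimensional majorant between central Morrey spaces. -/
theorem lintegral_commutatorMajorant_rpow_le {P Q r l β : ℝ} (hP : 1 < P) (hQ : 1 < Q)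
    (hr : 1 < r) (hPQ : 1 / r = 1 / P + 1 / Q) {b f : ℝ → ℂ} (hb : Measurable b)
    (hf : Measurable f) {M N : ℝ≥0∞}
    (hN : ∀ R : ℝ, 0 < R → ∫⁻ x in Ioo 0 R, ‖f x‖ₑ ^ P ≤
      N ^ P * ENNReal.ofReal (2 * R) ^ (1 + l * P))
    (hM : ∀ R : ℝ, 0 < R → ∃ c : ℂ, ∫⁻ x in Ioo 0 R, ‖b x - c‖ₑ ^ Q ≤
      M ^ Q * ENNReal.ofReal (2 * R))
    {R : ℝ} (hR : 0 < R) :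
    ∫⁻ x in Ioo 0 R, commutatorMajorant β b f x ^ r ≤
      (2 * M * N * ENNReal.ofReal (2 * R) ^ (1 / r + l) *
        ∫⁻ s in Ioo (0 : ℝ) 1, ENNReal.ofReal (s ^ (l - 1 / Q)) *
          ENNReal.ofReal ((1 - s) ^ (β - 1))) ^ r := by
  have e : ∫⁻ x in Ioo 0 R, commutatorMajorant β b f x ^ r =
      ∫⁻ x in Ioo 0 R, (∫⁻ s in Ioo (0 : ℝ) 1, ‖f (s * x)‖ₑ * ‖b x - b (s * x)‖ₑ *
        ENNReal.ofReal ((1 - s) ^ (β - 1))) ^ r :=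
    setLIntegral_congr_fun measurableSet_Ioo fun x hx => by
      simp only [commutatorMajorant_eq_lintegral_Ioo_zero_one β b f hx.1]
  rw [e]
  refine lintegral_rpow_lintegral_le hr (by fun_prop) (by fun_prop) ?_ ?_ ?_
  · filter_upwards [ae_restrict_mem measurableSet_Ioo] with s hs
    simp only [ne_eq, mul_eq_zero, ENNReal.ofReal_eq_zero, not_or, not_le]
    exact ⟨Real.rpow_pos_of_pos hs.1 _, Real.rpow_pos_of_pos (by linarith [hs.2]) _⟩
  · exact .of_forall fun s => ENNReal.mul_ne_top ENNReal.ofReal_ne_top ENNReal.ofReal_ne_top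
  · filter_upwards [ae_restrict_mem measurableSet_Ioo] with s hs
    simp only [ENNReal.mul_rpow_of_nonneg _ (ENNReal.ofReal ((1 - s) ^ (β - 1)))
      (by linarith : 0 ≤ r)]
    rw [lintegral_mul_const' _ _ (by finiteness), ← mul_assoc,
      ENNReal.mul_rpow_of_nonneg _ (ENNReal.ofReal ((1 - s) ^ (β - 1))) (by linarith : 0 ≤ r)]
    gcongr
    exact lintegral_dilation_rpow_le hP hQ (by linarith) hPQ hb hf hN hM hR hs

/-! ### Central norms on a fixed ball, and independence of null sets. -/

theorem lintegral_ball_le_centralMorreyNorm {p l : ℝ} (hp : 0 < p) (μ : Measure ℝ) (f : ℝ → ℂ)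
    {R : ℝ} (hR : 0 < R) :
    ∫⁻ x in Metric.ball (0 : ℝ) R, ‖f x‖ₑ ^ p ∂μ ≤
      centralMorreyNorm p l μ f ^ p * ENNReal.ofReal (2 * R) ^ (1 + l * p) := by
  have hV : ENNReal.ofReal (2 * R) ≠ 0 := by simpa using hR
  have h := le_iSup₂ (f := fun (R : ℝ) (_ : 0 < R) =>
    ((∫⁻ x in Metric.ball (0 : ℝ) R, ‖f x‖ₑ ^ p ∂μ) /
      (volume (Metric.ball (0 : ℝ) R)) ^ (1 + l * p)) ^ (1 / p)) R hR
  have h' := ENNReal.rpow_le_rpow h hp.le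
  rw [← ENNReal.rpow_mul, one_div_mul_cancel hp.ne', ENNReal.rpow_one, Real.volume_ball] at h'
  exact (ENNReal.div_le_iff ((ENNReal.rpow_pos (pos_iff_ne_zero.2 hV) ENNReal.ofReal_ne_top).ne')
    (ENNReal.rpow_ne_top_of_ne_zero hV ENNReal.ofReal_ne_top)).1 h'

theorem centralMorreyNorm_le_of_lintegral_ball_le {p l : ℝ} (hp : 0 < p) {μ : Measure ℝ}
    {f : ℝ → ℂ} {A : ℝ≥0∞}
    (h : ∀ R : ℝ, 0 < R → ∫⁻ x in Metric.ball (0 : ℝ) R, ‖f x‖ₑ ^ p ∂μ ≤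
      A ^ p * ENNReal.ofReal (2 * R) ^ (1 + l * p)) :
    centralMorreyNorm p l μ f ≤ A := by
  refine iSup₂_le fun R hR => ?_
  have hV : ENNReal.ofReal (2 * R) ≠ 0 := by simpa using hR
  calc _ ≤ (A ^ p) ^ (1 / p) := by
        rw [Real.volume_ball]
        gcongr
        exact (ENNReal.div_le_iff ((ENNReal.rpow_pos (pos_iff_ne_zero.2 hV) ENNReal.ofReal_ne_top).ne')
          (ENNReal.rpow_ne_top_of_ne_zero hV ENNReal.ofReal_ne_top)).2 (h R hR)
    _ = A := by rw [← ENNReal.rpow_mul, mul_one_div_cancel hp.ne', ENNReal.rpow_one]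

/-- The constant is the mean over the ball; the estimates need only that some constant works. -/
theorem exists_lintegral_ball_le_centralMeanOscillationNorm {q : ℝ} (hq : 0 < q) (b : ℝ → ℂ)
    {R : ℝ} (hR : 0 < R) :
    ∃ c : ℂ, ∫⁻ x in Metric.ball (0 : ℝ) R, ‖b x - c‖ₑ ^ q ≤
      centralMeanOscillationNorm q b ^ q * ENNReal.ofReal (2 * R) := by
  have hV : ENNReal.ofReal (2 * R) ≠ 0 := by simpa using hR
  have h := le_iSup₂ (f := fun (R : ℝ) (_ : 0 < R) =>
    ((∫⁻ x in Metric.ball (0 : ℝ) R, ‖b x - ⨍ y in Metric.ball (0 : ℝ) R, b y‖ₑ ^ q) /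
      volume (Metric.ball (0 : ℝ) R)) ^ (1 / q)) R hR
  have h' := ENNReal.rpow_le_rpow h hq.le
  rw [← ENNReal.rpow_mul, one_div_mul_cancel hq.ne', ENNReal.rpow_one, Real.volume_ball] at h'
  exact ⟨_, (ENNReal.div_le_iff hV ENNReal.ofReal_ne_top).1 h'⟩

theorem Ioo_zero_subset_ball (R : ℝ) : Ioo (0 : ℝ) R ⊆ Metric.ball 0 R := fun x hx => by
  rw [Metric.mem_ball, dist_zero_right, Real.norm_eq_abs, abs_of_pos hx.1]
  exact hx.2

/-- Only an upper bound is used, and in this direction no measurability of `g` is required. -/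
theorem lintegral_ball_halfLinePowerMeasure_le (c R : ℝ) (g : ℝ → ℝ≥0∞) :
    ∫⁻ x in Metric.ball (0 : ℝ) R, g x ∂(halfLinePowerMeasure c) ≤
      ∫⁻ x in Ioo 0 R, ENNReal.ofReal (x ^ (-c)) * g x := by
  rw [halfLinePowerMeasure, restrict_withDensity Metric.isOpen_ball.measurableSet,
    Measure.restrict_restrict Metric.isOpen_ball.measurableSet]
  have e : Metric.ball (0 : ℝ) R ∩ Ioi 0 = Ioo 0 R := by
    rw [Real.ball_eq_Ioo]; ext x; simp only [mem_inter_iff, mem_Ioo, mem_Ioi]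
    constructor
    · rintro ⟨⟨_, h⟩, h'⟩; exact ⟨h', by linarith⟩
    · rintro ⟨h, h'⟩; exact ⟨⟨by linarith, by linarith⟩, h⟩
  rw [e]
  exact lintegral_withDensity_le_lintegral_mul _ (by fun_prop) _

theorem halfLinePowerMeasure_absolutelyContinuous (c : ℝ) :
    halfLinePowerMeasure c ≪ volume.restrict (Ioi (0 : ℝ)) :=
  withDensity_absolutelyContinuous _ _

theorem aestronglyMeasurable_of_forall_isCompact {q : ℝ≥0∞} {f : ℝ → ℂ}
    (h : ∀ K : Set ℝ, IsCompact K → MemLp f q (volume.restrict K)) :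
    AEStronglyMeasurable f volume := by
  have hU : (⋃ n : ℕ, Metric.closedBall (0 : ℝ) n) = univ := Metric.iUnion_closedBall_nat 0
  rw [← Measure.restrict_univ (μ := volume), ← hU, aestronglyMeasurable_iUnion_iff]
  exact fun n => (h _ (isCompact_closedBall 0 _)).1

theorem commutatorMajorant_congr_ae {β : ℝ} {b b' f f' : ℝ → ℂ} (hb : b =ᵐ[volume] b')
    (hf : f =ᵐ[volume] f') :
    commutatorMajorant β b f =ᵐ[volume] commutatorMajorant β b' f' := by
  filter_upwards [hb] with x hx
  unfold commutatorMajorant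
  congr 1
  refine lintegral_congr_ae ?_
  filter_upwards [ae_restrict_of_ae hb, ae_restrict_of_ae hf] with t h1 h2
  rw [hx, h1, h2]

theorem aemeasurable_commutatorMajorant {β : ℝ} {b f : ℝ → ℂ} (hb : AEMeasurable b)
    (hf : AEMeasurable f) :
    AEMeasurable (commutatorMajorant β b f) (volume.restrict (Ioi 0)) := by
  have h := measurable_commutatorMajorant (β := β) hb.measurable_mk hf.measurable_mk
  refine AEMeasurable.congr ((aemeasurable_indicator_iff measurableSet_Ioi).1 h.aemeasurable) ?_
  exact ae_restrict_of_ae (commutatorMajorant_congr_ae hb.ae_eq_mk.symm hf.ae_eq_mk.symm)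

/-- The one-dimensional estimate for functions in the central Morrey and central BMO spaces. -/
theorem lintegral_commutatorMajorant_rpow_le_centralMorreyNorm {P Q r l β : ℝ} (hP : 1 < P)
    (hQ : 1 < Q) (hr : 1 < r) (hPQ : 1 / r = 1 / P + 1 / Q) {b f : ℝ → ℂ} (hb : AEMeasurable b)
    (hf : AEMeasurable f) {R : ℝ} (hR : 0 < R) :
    ∫⁻ x in Ioo 0 R, commutatorMajorant β b f x ^ r ≤
      (2 * centralMeanOscillationNorm Q b * centralMorreyNorm P l volume f *
        ENNReal.ofReal (2 * R) ^ (1 / r + l) *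
        ∫⁻ s in Ioo (0 : ℝ) 1, ENNReal.ofReal (s ^ (l - 1 / Q)) *
          ENNReal.ofReal ((1 - s) ^ (β - 1))) ^ r := by
  -- Passing to Borel representatives changes the majorant only on a null set of `x`.
  have e : ∫⁻ x in Ioo 0 R, commutatorMajorant β b f x ^ r =
      ∫⁻ x in Ioo 0 R, commutatorMajorant β (hb.mk b) (hf.mk f) x ^ r := by
    refine lintegral_congr_ae (ae_restrict_of_ae ?_)
    filter_upwards [commutatorMajorant_congr_ae (β := β) hb.ae_eq_mk hf.ae_eq_mk] with x hx
    rw [hx]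
  rw [e]
  refine lintegral_commutatorMajorant_rpow_le hP hQ hr hPQ hb.measurable_mk hf.measurable_mk
    (fun R hR => ?_) (fun R hR => ?_) hR
  · refine le_trans ?_ (lintegral_ball_le_centralMorreyNorm (by linarith) volume f hR)
    refine le_trans (lintegral_mono_set (Ioo_zero_subset_ball R)) (le_of_eq ?_)
    refine lintegral_congr_ae (ae_restrict_of_ae ?_)
    filter_upwards [hf.ae_eq_mk] with x hx
    rw [hx]
  · obtain ⟨c, hc⟩ := exists_lintegral_ball_le_centralMeanOscillationNorm (q := Q) (by linarith) b hR
    refine ⟨c, le_trans ?_ hc⟩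
    refine le_trans (lintegral_mono_set (Ioo_zero_subset_ball R)) (le_of_eq ?_)
    refine lintegral_congr_ae (ae_restrict_of_ae ?_)
    filter_upwards [hb.ae_eq_mk] with x hx
    rw [hx]

/-! ### Domination and measurability of the multilinear commutator. -/

/-- The exponent `-(m - α)` is shared equally among the coordinates, each receiving `α / m - 1 < 0`;
replacing the norm by the smaller `x - t i` then increases each factor. -/
theorem enorm_riemannLiouvilleCommutatorIntegrand_le {m : ℕ} {α : ℝ} (hαm : α < m) (hm : 0 < m)
    (b f : Fin m → ℝ → ℂ) {x : ℝ} {t : Fin m → ℝ} (ht : ∀ i, t i < x) :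
    ‖riemannLiouvilleCommutatorIntegrand α b f x t‖ₑ ≤
      ∏ i, ‖f i (t i)‖ₑ * ‖b i x - b i (t i)‖ₑ * ENNReal.ofReal ((x - t i) ^ (α / m - 1)) := by
  set w : EuclideanSpace ℝ (Fin m) := WithLp.toLp 2 (fun i => x - t i) with hw
  have hm' : (0 : ℝ) < m := by exact_mod_cast hm
  have hi : ∀ i, x - t i ≤ ‖w‖ := fun i => by
    have := PiLp.norm_apply_le w i
    exact (le_abs_self _).trans this
  have hw0 : 0 < ‖w‖ := lt_of_lt_of_le (sub_pos.2 (ht ⟨0, hm⟩)) (hi _)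
  have hker : (‖w‖ ^ ((m : ℝ) - α))⁻¹ ≤ ∏ i, (x - t i) ^ (α / m - 1) := by
    calc (‖w‖ ^ ((m : ℝ) - α))⁻¹ = ∏ _i : Fin m, ‖w‖ ^ (α / m - 1) := by
          rw [Finset.prod_const, Finset.card_univ, Fintype.card_fin, ← Real.rpow_natCast,
            ← Real.rpow_mul hw0.le, ← Real.rpow_neg hw0.le]
          congr 1
          field_simp
          ring
      _ ≤ _ := Finset.prod_le_prod (fun i _ => by positivity) fun i _ =>
          Real.rpow_le_rpow_of_nonpos (sub_pos.2 (ht i)) (hi i) (by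
            rw [sub_nonpos, div_le_one hm']; exact hαm.le)
  have hprod : ∀ i ∈ Finset.univ, 0 ≤ (x - t i) ^ (α / m - 1) := fun i _ =>
    Real.rpow_nonneg (sub_pos.2 (ht i)).le _
  rw [Finset.prod_mul_distrib, Finset.prod_mul_distrib, ← ENNReal.ofReal_prod_of_nonneg hprod,
    riemannLiouvilleCommutatorIntegrand, div_eq_mul_inv, enorm_mul, enorm_mul,
    ← ofReal_norm (∏ i, f i (t i)), ← ofReal_norm (∏ i, (b i x - b i (t i)))]
  rw [norm_prod, norm_prod, ENNReal.ofReal_prod_of_nonneg (fun _ _ => norm_nonneg _),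
    ENNReal.ofReal_prod_of_nonneg (fun _ _ => norm_nonneg _)]
  simp only [ofReal_norm]
  gcongr
  rw [← Complex.ofReal_inv, ← ofReal_norm, Complex.norm_real, Real.norm_eq_abs,
    abs_of_nonneg (by positivity)]
  exact ENNReal.ofReal_le_ofReal hker

/-- The multilinear commutator is pointwise dominated by a product of one-dimensional operators. -/
theorem lintegral_enorm_riemannLiouvilleCommutatorIntegrand_le {m : ℕ} {α : ℝ} (hαm : α < m)
    (hm : 0 < m) {b f : Fin m → ℝ → ℂ} (hb : ∀ i, AEMeasurable (b i))
    (hf : ∀ i, AEMeasurable (f i)) {x : ℝ} (hx : 0 < x) :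
    ENNReal.ofReal (x ^ (-α)) * ∫⁻ t in {t : Fin m → ℝ | ∀ i, 0 < t i ∧ t i < x},
        ‖riemannLiouvilleCommutatorIntegrand α b f x t‖ₑ ≤
      ∏ i, commutatorMajorant (α / m) (b i) (f i) x := by
  have hset : {t : Fin m → ℝ | ∀ i, 0 < t i ∧ t i < x} = univ.pi fun _ => Ioo 0 x := by
    ext t; simp [mem_pi]
  have hm' : (m : ℝ) ≠ 0 := by exact_mod_cast hm.ne'
  have hmeas : MeasurableSet (univ.pi fun _ : Fin m => Ioo (0 : ℝ) x) :=
    MeasurableSet.univ_pi fun _ => measurableSet_Ioo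
  have h1 : ∫⁻ t in univ.pi fun _ : Fin m => Ioo (0 : ℝ) x,
      ‖riemannLiouvilleCommutatorIntegrand α b f x t‖ₑ ≤
      ∏ i, ∫⁻ s in Ioo 0 x, ‖f i s‖ₑ * ‖b i x - b i s‖ₑ *
        ENNReal.ofReal ((x - s) ^ (α / m - 1)) := by
    refine (setLIntegral_mono' hmeas fun t ht =>
      enorm_riemannLiouvilleCommutatorIntegrand_le hαm hm b f fun i => (ht i trivial).2).trans ?_
    rw [volume_pi, Measure.restrict_pi_pi]
    refine (lintegral_fin_prod_eq_prod fun i => ?_).le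
    have h1 := (hf i).restrict (s := Ioo 0 x)
    have h2 := (hb i).restrict (s := Ioo 0 x)
    fun_prop
  have h2 : ENNReal.ofReal (x ^ (-α)) = ∏ _i : Fin m, ENNReal.ofReal (x ^ (-(α / m))) := by
    rw [Finset.prod_const, Finset.card_univ, Fintype.card_fin,
      ← ENNReal.ofReal_pow (by positivity), ← Real.rpow_natCast, ← Real.rpow_mul hx.le]
    congr 2
    field_simp
  rw [hset]
  simp only [commutatorMajorant]
  rw [Finset.prod_mul_distrib, ← h2]
  gcongr

theorem aestronglyMeasurable_riemannLiouvilleCommutatorIntegrand {m : ℕ} {α : ℝ}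
    {b f : Fin m → ℝ → ℂ} (hb : ∀ i, AEStronglyMeasurable (b i))
    (hf : ∀ i, AEStronglyMeasurable (f i)) (x : ℝ) :
    AEStronglyMeasurable (riemannLiouvilleCommutatorIntegrand α b f x) volume := by
  have h1 : ∀ i, AEStronglyMeasurable (fun t : Fin m → ℝ => f i (t i)) volume := fun i =>
    (hf i).comp_quasiMeasurePreserving (Measure.quasiMeasurePreserving_eval _ i)
  have h2 : ∀ i, AEStronglyMeasurable (fun t : Fin m → ℝ => b i (t i)) volume := fun i =>
    (hb i).comp_quasiMeasurePreserving (Measure.quasiMeasurePreserving_eval _ i)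
  refine AEStronglyMeasurable.div₀ ?_ ?_
  · exact (Finset.aestronglyMeasurable_fun_prod _ fun i _ => h1 i).mul
      (Finset.aestronglyMeasurable_fun_prod _ fun i _ => aestronglyMeasurable_const.sub (h2 i))
  · exact Measurable.aestronglyMeasurable (by fun_prop)

/-- The region of integration moves with `x`, so it is encoded as an indicator on the product space
before integrating out `t`. -/
theorem aestronglyMeasurable_riemannLiouvilleCommutator {m : ℕ} {α : ℝ}
    {b f : Fin m → ℝ → ℂ} (hb : ∀ i, AEStronglyMeasurable (b i))
    (hf : ∀ i, AEStronglyMeasurable (f i)) :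
    AEStronglyMeasurable (riemannLiouvilleCommutator α b f) volume := by
  have hf' : ∀ i, AEStronglyMeasurable (fun t : Fin m → ℝ => f i (t i)) volume := fun i =>
    (hf i).comp_quasiMeasurePreserving (Measure.quasiMeasurePreserving_eval _ i)
  have hb' : ∀ i, AEStronglyMeasurable (fun t : Fin m → ℝ => b i (t i)) volume := fun i =>
    (hb i).comp_quasiMeasurePreserving (Measure.quasiMeasurePreserving_eval _ i)
  have h1 : ∀ i, AEStronglyMeasurable (fun z : ℝ × (Fin m → ℝ) => f i (z.2 i))
      (volume.prod volume) := fun i => (hf' i).comp_snd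
  have h2 : ∀ i, AEStronglyMeasurable (fun z : ℝ × (Fin m → ℝ) => b i (z.2 i))
      (volume.prod volume) := fun i => (hb' i).comp_snd
  have h3 : ∀ i, AEStronglyMeasurable (fun z : ℝ × (Fin m → ℝ) => b i z.1)
      (volume.prod volume) := fun i => (hb i).comp_fst
  have hI : AEStronglyMeasurable (fun z : ℝ × (Fin m → ℝ) =>
      riemannLiouvilleCommutatorIntegrand α b f z.1 z.2) (volume.prod volume) := by
    refine AEStronglyMeasurable.div₀ ?_ ?_
    · exact (Finset.aestronglyMeasurable_fun_prod _ fun i _ => h1 i).mul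
        (Finset.aestronglyMeasurable_fun_prod _ fun i _ => (h3 i).sub (h2 i))
    · exact Measurable.aestronglyMeasurable (by fun_prop)
  have hset : MeasurableSet {z : ℝ × (Fin m → ℝ) | ∀ i, 0 < z.2 i ∧ z.2 i < z.1} := by
    simp only [ofPred_forall, ofPred_and]
    exact MeasurableSet.iInter fun i => (measurableSet_lt (by fun_prop) (by fun_prop)).inter
      (measurableSet_lt (by fun_prop) (by fun_prop))
  have hx : ∀ x : ℝ, MeasurableSet {t : Fin m → ℝ | ∀ i, 0 < t i ∧ t i < x} := fun x =>
    measurable_prodMk_left (x := x) hset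
  have hint := (hI.indicator hset).integral_prod_right'
  refine (hint.const_mul ((1 / Real.Gamma α : ℝ) : ℂ)).congr (.of_forall fun x => ?_)
  simp only [riemannLiouvilleCommutator]
  rw [← integral_indicator (hx x)]
  rfl

/-! ### Hölder over the factors and the conclusion. -/

/-- Hölder's inequality for the product of one-dimensional majorants. -/
theorem lintegral_prod_commutatorMajorant_rpow_le {m : ℕ} {p β : ℝ} {ps qs lams : Fin m → ℝ}
    (hp : 1 < p) (hps : ∀ i, 1 < ps i) (hqs : ∀ i, 1 < qs i)
    (hexp : 1 / p = ∑ i, 1 / ps i + ∑ i, 1 / qs i) {b f : Fin m → ℝ → ℂ}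
    (hb : ∀ i, AEMeasurable (b i)) (hf : ∀ i, AEMeasurable (f i)) {R : ℝ} (hR : 0 < R) :
    ∫⁻ x in Ioo 0 R, (∏ i, commutatorMajorant β (b i) (f i) x) ^ p ≤
      ((∏ i, 2 * centralMeanOscillationNorm (qs i) (b i) *
        ∫⁻ s in Ioo (0 : ℝ) 1, ENNReal.ofReal (s ^ (lams i - 1 / qs i)) *
          ENNReal.ofReal ((1 - s) ^ (β - 1))) *
        ∏ i, centralMorreyNorm (ps i) (lams i) volume (f i)) ^ p *
      ENNReal.ofReal (2 * R) ^ (1 + (∑ i, lams i) * p) := by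
  have hp0 : 0 < p := by linarith
  have hP0 : ∀ i, 0 < 1 / ps i := fun i => one_div_pos.2 (by linarith [hps i])
  have hQ0 : ∀ i, 0 < 1 / qs i := fun i => one_div_pos.2 (by linarith [hqs i])
  set r : Fin m → ℝ := fun i => 1 / (1 / ps i + 1 / qs i) with hr
  have hr' : ∀ i, 1 / r i = 1 / ps i + 1 / qs i := fun i => one_div_one_div _
  have hsum : ∑ i, 1 / r i = 1 / p := by
    rw [hexp, ← Finset.sum_add_distrib]; exact Finset.sum_congr rfl fun i _ => hr' i
  have hr0 : ∀ i, 0 < r i := fun i => one_div_pos.2 (add_pos (hP0 i) (hQ0 i))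
  -- Minkowski needs `r i > 1`: `1 / r i` is one term of a positive sum equal to `1 / p < 1`.
  have hr1 : ∀ i, 1 < r i := fun i => by
    have h1 : 1 / r i ≤ 1 / p := by
      rw [← hsum]
      exact Finset.single_le_sum (f := fun i => 1 / r i)
        (fun j _ => (one_div_pos.2 (hr0 j)).le) (Finset.mem_univ i)
    have h2 : 1 / p < 1 := by rw [div_lt_one hp0]; exact hp
    have h3 : 1 / r i < 1 / 1 := by rw [one_div_one]; linarith
    exact (one_div_lt_one_div (hr0 i) one_pos).1 h3
  have hVp : ∏ i, ENNReal.ofReal (2 * R) ^ (1 / r i + lams i) =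
      ENNReal.ofReal (2 * R) ^ (1 / p + ∑ i, lams i) := by
    rw [← hsum, ← Finset.sum_add_distrib]
    have h2R : 0 < 2 * R := by linarith
    simp only [ENNReal.ofReal_rpow_of_pos h2R]
    rw [← ENNReal.ofReal_prod_of_nonneg fun i _ => by positivity,
      Real.rpow_sum_of_pos h2R]
  have hmeas : ∀ i, AEMeasurable (commutatorMajorant β (b i) (f i)) (volume.restrict (Ioo 0 R)) :=
    fun i => (aemeasurable_commutatorMajorant (hb i) (hf i)).mono_measure
      (Measure.restrict_mono Ioo_subset_Ioi_self le_rfl)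
  calc ∫⁻ x in Ioo 0 R, (∏ i, commutatorMajorant β (b i) (f i) x) ^ p
      = ∫⁻ x in Ioo 0 R, ∏ i, (commutatorMajorant β (b i) (f i) x ^ r i) ^ (p / r i) := by
        refine lintegral_congr fun x => ?_
        rw [← ENNReal.prod_rpow_of_nonneg hp0.le]
        refine Finset.prod_congr rfl fun i _ => ?_
        rw [← ENNReal.rpow_mul, mul_div_cancel₀ _ (hr0 i).ne']
    -- Hölder with weights `p / r i`, which sum to one.
    _ ≤ ∏ i, (∫⁻ x in Ioo 0 R, commutatorMajorant β (b i) (f i) x ^ r i) ^ (p / r i) := by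
        refine ENNReal.lintegral_prod_norm_pow_le _ (fun i _ => (hmeas i).pow_const _) ?_
          fun i _ => (div_pos hp0 (hr0 i)).le
        rw [← mul_one_div_cancel hp0.ne', ← hsum, Finset.mul_sum]
        exact Finset.sum_congr rfl fun i _ => by ring
    _ ≤ ∏ i, (2 * centralMeanOscillationNorm (qs i) (b i) *
          centralMorreyNorm (ps i) (lams i) volume (f i) *
          ENNReal.ofReal (2 * R) ^ (1 / r i + lams i) *
          ∫⁻ s in Ioo (0 : ℝ) 1, ENNReal.ofReal (s ^ (lams i - 1 / qs i)) *
            ENNReal.ofReal ((1 - s) ^ (β - 1))) ^ p := by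
        refine Finset.prod_le_prod' fun i _ => ?_
        refine (ENNReal.rpow_le_rpow (lintegral_commutatorMajorant_rpow_le_centralMorreyNorm (l := lams i)
          (hps i) (hqs i) (hr1 i) (hr' i) (hb i) (hf i) hR) (div_pos hp0 (hr0 i)).le).trans_eq ?_
        rw [← ENNReal.rpow_mul, mul_div_cancel₀ _ (hr0 i).ne']
    _ = _ := by
        rw [ENNReal.prod_rpow_of_nonneg hp0.le,
          show 1 + (∑ i, lams i) * p = (1 / p + ∑ i, lams i) * p by field_simp,
          ENNReal.rpow_mul, ← hVp, ← ENNReal.mul_rpow_of_nonneg _ _ hp0.le]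
        simp only [Finset.prod_mul_distrib]
        congr 1
        ring

theorem mainTheorem9 (m : ℕ) (α : ℝ) (hα : 0 < α) (hαm : α < m)
    (p lam : ℝ) (ps qs lams : Fin m → ℝ)
    (hp : 1 < p) (hps : ∀ i, p < ps i) (hqs : ∀ i, 1 < qs i)
    (hlams : ∀ i, -(1 / ps i) < lams i ∧ lams i < 0)
    (hexp : 1 / p = ∑ i, 1 / ps i + ∑ i, 1 / qs i)
    (hlam : lam = ∑ i, lams i)
    (b : Fin m → ℝ → ℂ) (hb : ∀ i, MemCentralBMO (qs i) (b i)) :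
    ∃ C : ℝ≥0, ∀ f : Fin m → ℝ → ℂ,
      (∀ i, MemCentralMorrey (ps i) (lams i) volume (f i)) →
        (∀ᵐ x ∂(volume.restrict (Ioi (0 : ℝ))),
          IntegrableOn (riemannLiouvilleCommutatorIntegrand α b f x)
            {t : Fin m → ℝ | ∀ i, 0 < t i ∧ t i < x}) ∧
        MemCentralMorrey p lam (halfLinePowerMeasure (p * α))
          (riemannLiouvilleCommutator α b f) ∧
        centralMorreyNorm p lam (halfLinePowerMeasure (p * α))
            (riemannLiouvilleCommutator α b f) ≤
          C * ∏ i, centralMorreyNorm (ps i) (lams i) volume (f i) := by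
  have hp0 : 0 < p := by linarith
  have hm' : (0 : ℝ) < m := hα.trans hαm
  have hm : 0 < m := by exact_mod_cast hm'
  have hΓ : 0 < Real.Gamma α := Real.Gamma_pos_of_pos hα
  -- With `lams i > -1 / ps i` this gives `lams i - 1 / qs i > -1`, the convergence of the Beta
  -- integral at `0`.
  have hPQ : ∀ i, 1 / ps i + 1 / qs i < 1 := fun i => by
    have h1 : 1 / ps i ≤ ∑ i, 1 / ps i := Finset.single_le_sum (f := fun i => 1 / ps i)
      (fun j _ => (one_div_pos.2 (by linarith [hps j])).le) (Finset.mem_univ i)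
    have h2 : 1 / qs i ≤ ∑ i, 1 / qs i := Finset.single_le_sum (f := fun i => 1 / qs i)
      (fun j _ => (one_div_pos.2 (by linarith [hqs j])).le) (Finset.mem_univ i)
    have h3 : 1 / p < 1 := by rw [div_lt_one hp0]; exact hp
    linarith
  set K : ℝ≥0∞ := ∏ i, 2 * centralMeanOscillationNorm (qs i) (b i) *
    ∫⁻ s in Ioo (0 : ℝ) 1, ENNReal.ofReal (s ^ (lams i - 1 / qs i)) *
      ENNReal.ofReal ((1 - s) ^ (α / m - 1)) with hK
  have hKt : K ≠ ∞ := ENNReal.prod_ne_top fun i _ =>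
    ENNReal.mul_ne_top (ENNReal.mul_ne_top (by simp) (hb i).norm_lt_top.ne)
      (lintegral_rpow_mul_one_sub_rpow_lt_top (by linarith [hPQ i, (hlams i).1])
        (by linarith [div_pos hα hm'])).ne
  set G : ℝ≥0∞ := ENNReal.ofReal (1 / Real.Gamma α) with hG
  have hDt : G * K ≠ ∞ := ENNReal.mul_ne_top ENNReal.ofReal_ne_top hKt
  refine ⟨(G * K).toNNReal, fun f hf => ?_⟩
  rw [ENNReal.coe_toNNReal hDt]
  have hbs : ∀ i, AEStronglyMeasurable (b i) volume := fun i =>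
    aestronglyMeasurable_of_forall_isCompact (hb i).memLp_of_isCompact
  have hfs : ∀ i, AEStronglyMeasurable (f i) volume := fun i =>
    aestronglyMeasurable_of_forall_isCompact (hf i).memLp_of_isCompact
  have hbm : ∀ i, AEMeasurable (b i) := fun i => (hbs i).aemeasurable
  have hfm : ∀ i, AEMeasurable (f i) := fun i => (hfs i).aemeasurable
  set N : ℝ≥0∞ := ∏ i, centralMorreyNorm (ps i) (lams i) volume (f i) with hN
  have hNt : N ≠ ∞ := ENNReal.prod_ne_top fun i _ => (hf i).norm_lt_top.ne
  set S : ℝ → ℝ≥0∞ := fun x => ∏ i, commutatorMajorant (α / m) (b i) (f i) x with hS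
  have hSm : AEMeasurable S (volume.restrict (Ioi 0)) :=
    Finset.aemeasurable_fun_prod _ fun i _ => aemeasurable_commutatorMajorant (hbm i) (hfm i)
  have hSle : ∀ R : ℝ, 0 < R → ∫⁻ x in Ioo 0 R, S x ^ p ≤
      (K * N) ^ p * ENNReal.ofReal (2 * R) ^ (1 + lam * p) := fun R hR => by
    rw [hlam]
    exact lintegral_prod_commutatorMajorant_rpow_le hp (fun i => hp.trans (hps i)) hqs hexp
      hbm hfm hR
  have hVt : ∀ R : ℝ, 0 < R → ENNReal.ofReal (2 * R) ^ (1 + lam * p) ≠ ∞ := fun R hR =>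
    ENNReal.rpow_ne_top_of_ne_zero (by simpa using hR) ENNReal.ofReal_ne_top
  -- Finite `L ^ p` norm on each `(0, n + 1)`, and these intervals exhaust the half-line.
  have hSfin : ∀ᵐ x ∂(volume.restrict (Ioi (0 : ℝ))), S x < ∞ := by
    have hU : Ioi (0 : ℝ) ⊆ ⋃ n : ℕ, Ioo (0 : ℝ) (n + 1) := fun x hx => by
      obtain ⟨n, hn⟩ := exists_nat_gt x
      exact mem_iUnion.2 ⟨n, hx, by linarith⟩
    refine ae_restrict_of_ae_restrict_of_subset hU ((ae_restrict_iUnion_iff _ _).2 fun n => ?_)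
    have hlt : ∫⁻ x in Ioo (0 : ℝ) (n + 1), S x ^ p < ∞ :=
      (hSle _ (by positivity)).trans_lt (ENNReal.mul_lt_top
        (ENNReal.rpow_lt_top_of_nonneg hp0.le (ENNReal.mul_ne_top hKt hNt))
        (hVt _ (by positivity)).lt_top)
    filter_upwards [ae_lt_top' ((hSm.mono_measure
      (Measure.restrict_mono Ioo_subset_Ioi_self le_rfl)).pow_const p) hlt.ne] with x hx
    exact (ENNReal.rpow_lt_top_iff_of_pos hp0).1 hx
  have hpt : ∀ x : ℝ, 0 < x → ENNReal.ofReal (x ^ (-α)) *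
      ∫⁻ t in {t : Fin m → ℝ | ∀ i, 0 < t i ∧ t i < x},
        ‖riemannLiouvilleCommutatorIntegrand α b f x t‖ₑ ≤ S x := fun x hx =>
    lintegral_enorm_riemannLiouvilleCommutatorIntegrand_le hαm hm hbm hfm hx
  have hT : ∀ x : ℝ, 0 < x → ENNReal.ofReal (x ^ (-(p * α))) *
      ‖riemannLiouvilleCommutator α b f x‖ₑ ^ p ≤ G ^ p * S x ^ p := fun x hx => by
    have h1 : ENNReal.ofReal (x ^ (-α)) * ‖riemannLiouvilleCommutator α b f x‖ₑ ≤ G * S x := by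
      refine le_trans ?_ (mul_le_mul_right (hpt x hx) G)
      rw [riemannLiouvilleCommutator, enorm_mul, mul_left_comm]
      have hc : ‖((1 / Real.Gamma α : ℝ) : ℂ)‖ₑ = G := by
        rw [← ofReal_norm, Complex.norm_real, Real.norm_eq_abs,
          abs_of_pos (one_div_pos.2 hΓ)]
      rw [hc]
      gcongr
      exact enorm_integral_le_lintegral_enorm _
    have h2 := ENNReal.rpow_le_rpow h1 hp0.le
    rw [ENNReal.mul_rpow_of_nonneg _ _ hp0.le, ENNReal.mul_rpow_of_nonneg _ _ hp0.le,
      ENNReal.ofReal_rpow_of_pos (Real.rpow_pos_of_pos hx _), ← Real.rpow_mul hx.le,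
      neg_mul, mul_comm α p] at h2
    exact h2
  have hball : ∀ R : ℝ, 0 < R → ∫⁻ x in Metric.ball (0 : ℝ) R,
      ‖riemannLiouvilleCommutator α b f x‖ₑ ^ p ∂(halfLinePowerMeasure (p * α)) ≤
      (G * K * N) ^ p * ENNReal.ofReal (2 * R) ^ (1 + lam * p) := fun R hR =>
    calc _ ≤ _ := lintegral_ball_halfLinePowerMeasure_le _ _ _
      _ ≤ ∫⁻ x in Ioo 0 R, G ^ p * S x ^ p :=
        setLIntegral_mono' measurableSet_Ioo fun x hx => hT x hx.1
      _ = G ^ p * ∫⁻ x in Ioo 0 R, S x ^ p :=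
        lintegral_const_mul' _ _ (ENNReal.rpow_ne_top_of_nonneg hp0.le ENNReal.ofReal_ne_top)
      _ ≤ G ^ p * ((K * N) ^ p * ENNReal.ofReal (2 * R) ^ (1 + lam * p)) := by
        gcongr; exact hSle R hR
      _ = _ := by rw [mul_assoc G, ENNReal.mul_rpow_of_nonneg G _ hp0.le, mul_assoc]
  have hnorm := centralMorreyNorm_le_of_lintegral_ball_le hp0 hball
  refine ⟨?_, ⟨fun Kc hKc => ?_, hnorm.trans_lt (ENNReal.mul_lt_top hDt.lt_top hNt.lt_top)⟩, hnorm⟩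
  · filter_upwards [hSfin, ae_restrict_mem measurableSet_Ioi] with x hx hx0
    refine ⟨(aestronglyMeasurable_riemannLiouvilleCommutatorIntegrand hbs hfs x).restrict, ?_⟩
    -- An infinite integral times the positive factor `x ^ (-α)` would force `S x = ∞`.
    refine lt_top_iff_ne_top.2 fun htop => ?_
    have h := (hpt x hx0).trans_lt hx
    rw [htop, ENNReal.mul_top] at h
    · exact lt_irrefl _ h
    · simpa using Real.rpow_pos_of_pos hx0 (-α)
  · refine ⟨((aestronglyMeasurable_riemannLiouvilleCommutator hbs hfs).restrict.mono_ac
      (halfLinePowerMeasure_absolutelyContinuous _)).restrict, ?_⟩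
    -- Local integrability for the weighted measure follows from the ball estimate, even for compact
    -- sets containing `0`.
    obtain ⟨R, hR, hKR⟩ := hKc.isBounded.subset_ball_lt 0 0
    rw [eLpNorm_lt_top_iff_lintegral_rpow_enorm_lt_top (by simpa using hp0) ENNReal.ofReal_ne_top,
      ENNReal.toReal_ofReal hp0.le]
    exact (lintegral_mono_set hKR).trans_lt ((hball R hR).trans_lt (ENNReal.mul_lt_top
      (ENNReal.rpow_lt_top_of_nonneg hp0.le (ENNReal.mul_ne_top hDt hNt)) (hVt R hR).lt_top))
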